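/- For a finite simple graph $G$ let $\lambda(G)$ be the spectral radius of its adjacency matrix. Write $G\vee H$ for the join and $G\cup H$ for the disjoint union of graphs, $kK_1$ for the graph with $k$ vertices and no edges, and $K_{1,k}$ for the star with $k$ leaves. Let $H(4,3)$ be the $6$-vertex graph formed by a $4$-cycle and a triangle that share exactly one vertex. A graph is $H(4,3)$-free if it has no (not necessarily induced) subgraph isomorphic to $H(4,3)$. **Theorem.** Let $m\ge 58$ be an odd integer and let $G$ be an $H(4,3)$-free finite simple graph with exactly $m$ edges and no isolated vertices that is not isomorphic to the book graph $K_2\vee\frac{m-1}{2}K_1$. Let $\tilde\lambda(m)$ be the largest real root of $$x^4-mx^2-(m-3)x+m-3=0$$ (the equation has a real root). Then $\lambda(G)\le\tilde\lambda(m)$, with equality if and only if $G\cong K_1\vee\bigl(K_{1,\frac{m-3}{2}}\cup 2K_1\bigr)$. -/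

import Mathlib

/-- The join of two graphs: their disjoint union together with every edge between the two parts. -/
def graphJoin {V W : Type*} (G : SimpleGraph V) (H : SimpleGraph W) : SimpleGraph (V ⊕ W) :=
  SimpleGraph.sum G H ⊔ completeBipartiteGraph V W

/-- The edgeless graph on `k` vertices, that is, `k` disjoint copies of `K_1`. -/
def emptyG (k : ℕ) : SimpleGraph (Fin k) := ⊥

/-- The complete graph `K_k`. -/
def completeG (k : ℕ) : SimpleGraph (Fin k) := ⊤

/-- The star `K_{1,k}`. -/
def starG (k : ℕ) : SimpleGraph (Fin 1 ⊕ Fin k) := completeBipartiteGraph (Fin 1) (Fin k)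

/-- The fish graph `H(4,3)`: the 4-cycle `0 1 2 3` and the triangle `0 4 5`, sharing vertex `0`. -/
def fishGraph : SimpleGraph (Fin 6) :=
  SimpleGraph.fromEdgeSet
    {s(0, 1), s(1, 2), s(2, 3), s(3, 0), s(0, 4), s(4, 5), s(5, 0)}

/-- The book graph `K_2 ∨ k K_1`. -/
def bookGraph (k : ℕ) : SimpleGraph (Fin 2 ⊕ Fin k) := graphJoin (completeG 2) (emptyG k)

/-- The graph `K_1 ∨ (K_{1,k} ∪ 2 K_1)`. -/
def extremalGraph (k : ℕ) : SimpleGraph (Fin 1 ⊕ ((Fin 1 ⊕ Fin k) ⊕ Fin 2)) :=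
  graphJoin (completeG 1) (SimpleGraph.sum (starG k) (emptyG 2))

/-- The spectral radius of a finite graph: the largest absolute value of an eigenvalue of its
adjacency matrix. That matrix is real symmetric, so all its eigenvalues are real. -/
noncomputable def graphSpectralRadius {V : Type*} [Fintype V] [DecidableEq V]
    (G : SimpleGraph V) [DecidableRel G.Adj] : ℝ :=
  (spectralRadius ℝ (G.adjMatrix ℝ)).toReal

open Finset SimpleGraph

/-! Write the quartic as `(x² - x - (m - 2)) * (x² + x - 1) - 1`; if `λ` is at least its largest
root `L`, then `λ² - λ > m - 2`. Scale a nonnegative eigenvector `x` for `λ` to have maximum `1`,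
attained at `o`. Counting edges and 2-walks from `o` forces more than six edges inside `N(o)`, not
all disjoint. A fish-free `N(o)` contains no disjoint `P_3` and `K_2`, so these edges form a star
with centre `v` and `r ≥ 4` leaves (`exists_isStarCenter`).

Then `t = λ² - λ - (m - 2)` is `1` minus nonnegative deficiencies
(`IsStarCenter.eigenvalue_identity`). Since `t > 0`, these total less than `1`; with `m` odd this
excludes vertices far from `o` (`IsStarCenter.farFinset_eq_empty`). So `G` is `K_1` joined to a star
and `s` isolated vertices, with `s` even. The eigenvalue equations leave `s = 0`, the book, or `s =
2`, where `λ` is a root of the quartic and hence equals `L`. Conversely, `L` has an explicit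
eigenvector on the extremal graph. -/

theorem SimpleGraph.false_of_fish {V : Type*} {G : SimpleGraph V} (h : fishGraph.Free G)
    {o a b c p q : V} (hoa : G.Adj o a) (hab : G.Adj a b) (hbc : G.Adj b c) (hco : G.Adj c o)
    (hop : G.Adj o p) (hpq : G.Adj p q) (hqo : G.Adj q o) (hob : o ≠ b) (hac : a ≠ c)
    (hap : a ≠ p) (haq : a ≠ q) (hbp : b ≠ p) (hbq : b ≠ q) (hcp : c ≠ p) (hcq : c ≠ q) :
    False := by
  refine h ⟨⟨⟨![o, a, b, c, p, q], ?_⟩, ?_⟩⟩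
  · intro i j hij
    have := hoa.symm; have := hab.symm; have := hbc.symm; have := hco.symm
    have := hop.symm; have := hpq.symm; have := hqo.symm
    fin_cases i <;> fin_cases j <;> simp [fishGraph] at hij ⊢ <;> assumption
  · have := hoa.ne; have := hab.ne; have := hbc.ne; have := hco.ne
    have := hop.ne; have := hpq.ne; have := hqo.ne
    intro i j hij
    fin_cases i <;> fin_cases j <;> simp_all

/-- The quartic is `-1` at the positive root `x₀` of `x² - x = m - 2` and positive from `x₀ + 1` on.
For `m ≥ 58`, `4 * m - 7 ≥ 15²`, so `x₀ ≥ 8`. -/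
theorem exists_greatest_root (m : ℝ) (hm : 58 ≤ m) :
    ∃ L : ℝ, IsGreatest {x : ℝ | x ^ 4 - m * x ^ 2 - (m - 3) * x + m - 3 = 0} L ∧
      8 < L ∧ ∀ x, L ≤ x → m - 2 < x ^ 2 - x := by
  have hcont : Continuous fun x : ℝ => x ^ 4 - m * x ^ 2 - (m - 3) * x + m - 3 := by fun_prop
  have hs : Real.sqrt (4 * m - 7) ^ 2 = 4 * m - 7 := Real.sq_sqrt (by linarith)
  have hs15 : 15 ≤ Real.sqrt (4 * m - 7) := Real.le_sqrt_of_sq_le (by linarith)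
  set s := Real.sqrt (4 * m - 7)
  set x₀ := (1 + s) / 2 with hx₀
  have hx8 : 8 ≤ x₀ := by linarith
  have hx₀m : x₀ ^ 2 - x₀ = m - 2 := by rw [hx₀]; linarith
  have hroot : ∀ x : ℝ, x ^ 4 - m * x ^ 2 - (m - 3) * x + m - 3 =
      (x ^ 2 - x - (m - 2)) * (x ^ 2 + x - 1) - 1 := fun x => by ring
  have hbig : ∀ x : ℝ, x₀ + 1 ≤ x → 0 < x ^ 4 - m * x ^ 2 - (m - 3) * x + m - 3 := by
    intro x hx
    rw [hroot]
    have h1 : 1 ≤ x ^ 2 - x - (m - 2) := by nlinarith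
    have h2 : 2 ≤ x ^ 2 + x - 1 := by nlinarith
    nlinarith
  obtain ⟨y, hy, hy0⟩ := intermediate_value_Icc (show x₀ ≤ x₀ + 1 by linarith) hcont.continuousOn
    (show (0 : ℝ) ∈ Set.Icc _ _ from ⟨by rw [hroot, hx₀m]; linarith, (hbig _ le_rfl).le⟩)
  have hK : IsCompact ({x : ℝ | x ^ 4 - m * x ^ 2 - (m - 3) * x + m - 3 = 0} ∩
      Set.Icc x₀ (x₀ + 1)) :=
    isCompact_Icc.inter_left (isClosed_eq hcont continuous_const)
  obtain ⟨L, ⟨hL0, hL1⟩, hLmax⟩ := hK.exists_isGreatest ⟨y, hy0, hy⟩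
  have hne : x₀ < L := by
    refine lt_of_le_of_ne hL1.1 fun h => ?_
    have h0 : L ^ 4 - m * L ^ 2 - (m - 3) * L + m - 3 = 0 := hL0
    rw [← h, hroot, hx₀m] at h0
    linarith
  refine ⟨L, ⟨hL0, fun x hx => ?_⟩, by linarith, fun x hx => by nlinarith⟩
  by_contra! hlt
  refine absurd (hLmax ⟨hx, by linarith, ?_⟩) (not_le.2 hlt)
  by_contra! h
  exact (hbig x h.le).ne' hx

/-! ### The spectral radius and a nonnegative eigenvector -/

section Spectral
variable {V : Type*} [Fintype V] [DecidableEq V]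

theorem graphSpectralRadius_spec [Nonempty V] (G : SimpleGraph V) [DecidableRel G.Adj] :
    (∀ μ ∈ spectrum ℝ (G.adjMatrix ℝ), |μ| ≤ graphSpectralRadius G) ∧
      ∃ μ ∈ spectrum ℝ (G.adjMatrix ℝ), |μ| = graphSpectralRadius G := by
  have hA : (G.adjMatrix ℝ).IsHermitian := G.isHermitian_adjMatrix ℝ
  obtain ⟨i, hi⟩ := Finite.exists_max fun i => ‖hA.eigenvalues i‖₊
  have hsp := hA.spectrum_real_eq_range_eigenvalues
  have hρ : graphSpectralRadius G = |hA.eigenvalues i| := by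
    have : spectralRadius ℝ (G.adjMatrix ℝ) = ‖hA.eigenvalues i‖₊ := by
      unfold spectralRadius
      rw [hsp]
      refine le_antisymm ?_ ?_
      · simp only [iSup_le_iff]
        rintro _ ⟨j, rfl⟩
        exact_mod_cast hi j
      · exact le_iSup₂_of_le _ ⟨i, rfl⟩ le_rfl
    simp [graphSpectralRadius, this]
  rw [hρ]
  refine ⟨?_, _, hsp ▸ ⟨i, rfl⟩, rfl⟩
  rw [hsp]
  rintro _ ⟨j, rfl⟩
  exact_mod_cast hi j

theorem mem_spectrum_iff_exists_mulVec (A : Matrix V V ℝ) (μ : ℝ) :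
    μ ∈ spectrum ℝ A ↔ ∃ x : V → ℝ, x ≠ 0 ∧ A.mulVec x = μ • x := by
  rw [← Matrix.spectrum_toLin', ← Module.End.hasEigenvalue_iff_mem_spectrum]
  constructor
  · intro h
    obtain ⟨x, hx⟩ := h.exists_hasEigenvector
    exact ⟨x, hx.2, by simpa using hx.apply_eq_smul⟩
  · rintro ⟨x, h0, hx⟩
    exact Module.End.hasEigenvalue_of_hasEigenvector
      ⟨Module.End.mem_eigenspace_iff.2 (by simpa using hx), h0⟩

/-- The spectral radius of a graph is an eigenvalue with a nonnegative eigenvector. -/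
theorem exists_nonneg_eigenvector [Nonempty V] (G : SimpleGraph V) [DecidableRel G.Adj] :
    ∃ x : V → ℝ, (∀ v, 0 ≤ x v) ∧ x ≠ 0 ∧
      (G.adjMatrix ℝ).mulVec x = graphSpectralRadius G • x := by
  obtain ⟨hle, μ, hμ, hμρ⟩ := graphSpectralRadius_spec G
  set ρ := graphSpectralRadius G
  set A := G.adjMatrix ℝ with hAdef
  obtain ⟨y, hy0, hy⟩ := (mem_spectrum_iff_exists_mulVec A μ).1 hμ
  -- No eigenvalue of `A` exceeds `ρ`, so a vector on which the form `ρ - A` vanishes lies in its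
  -- kernel. This avoids Perron–Frobenius and needs no connectedness.
  have hpsd : (ρ • (1 : Matrix V V ℝ) - A).PosSemidef := by
    rw [Matrix.posSemidef_iff_isHermitian_and_spectrum_nonneg]
    refine ⟨?_, ?_⟩
    · refine Matrix.IsHermitian.sub ?_ (G.isHermitian_adjMatrix ℝ)
      simp [Matrix.IsHermitian]
    · intro ν hν
      obtain ⟨z, hz0, hz⟩ := (mem_spectrum_iff_exists_mulVec _ ν).1 hν
      have : ρ - ν ∈ spectrum ℝ A := by
        refine (mem_spectrum_iff_exists_mulVec _ _).2 ⟨z, hz0, ?_⟩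
        rw [Matrix.sub_mulVec, Matrix.smul_mulVec, Matrix.one_mulVec] at hz
        rw [sub_smul, ← hz]
        abel
      have := (abs_le.1 (hle _ this)).2
      simpa using this
  refine ⟨fun v => |y v|, fun v => abs_nonneg _, fun h => hy0 ?_, ?_⟩
  · ext v
    simpa using congrFun h v
  -- The entries of `A` are nonnegative, so passing to `|y|` gives a form value of at least `|μ| =
  -- ρ` times the squared norm, even if `μ = -ρ`.
  have hquad : (fun v => |y v|) ⬝ᵥ A.mulVec (fun v => |y v|) ≥ ρ * ∑ v, |y v| * |y v| := by
    have h1 : y ⬝ᵥ A.mulVec y = μ * ∑ v, |y v| * |y v| := by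
      rw [hy, dotProduct_smul]
      simp [dotProduct]
    have h2 : |y ⬝ᵥ A.mulVec y| ≤ (fun v => |y v|) ⬝ᵥ A.mulVec (fun v => |y v|) := by
      simp only [dotProduct, Matrix.mulVec, Finset.mul_sum]
      refine (Finset.abs_sum_le_sum_abs _ _).trans (Finset.sum_le_sum fun i _ => ?_)
      refine (Finset.abs_sum_le_sum_abs _ _).trans (Finset.sum_le_sum fun j _ => ?_)
      rw [abs_mul, abs_mul]
      gcongr
      rw [hAdef, adjMatrix_apply]
      split_ifs <;> simp
    rw [h1, abs_mul, hμρ, abs_of_nonneg (Finset.sum_nonneg fun v _ =>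
      mul_nonneg (abs_nonneg _) (abs_nonneg _))] at h2
    exact h2
  have hzero := (hpsd.dotProduct_mulVec_zero_iff (fun v => |y v|)).1 (by
    refine le_antisymm ?_ (hpsd.dotProduct_mulVec_nonneg _)
    rw [Matrix.sub_mulVec, Matrix.smul_mulVec, Matrix.one_mulVec, dotProduct_sub, dotProduct_smul]
    have : star (fun v => |y v|) = fun v => |y v| := by ext; simp
    rw [this]
    simp only [dotProduct, smul_eq_mul] at hquad ⊢
    linarith)
  rw [Matrix.sub_mulVec, Matrix.smul_mulVec, Matrix.one_mulVec, sub_eq_zero] at hzero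
  exact hzero.symm

theorem exists_normalized_eigenvector [Nonempty V] (G : SimpleGraph V) [DecidableRel G.Adj] :
    ∃ (x : V → ℝ) (o : V), (∀ v, 0 ≤ x v) ∧ (∀ v, x v ≤ 1) ∧ x o = 1 ∧
      ∀ v, graphSpectralRadius G * x v = ∑ w ∈ G.neighborFinset v, x w := by
  obtain ⟨x, hx, hx0, he⟩ := exists_nonneg_eigenvector G
  obtain ⟨o, ho⟩ := Finite.exists_max x
  have hpos : 0 < x o := by
    obtain ⟨v, hv⟩ := Function.ne_iff.1 hx0
    exact ((hx v).lt_of_ne' hv).trans_le (ho v)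
  refine ⟨fun v => x v / x o, o, fun v => div_nonneg (hx v) hpos.le,
    fun v => (div_le_one hpos).2 (ho v), div_self hpos.ne', fun v => ?_⟩
  have := congrFun he v
  rw [adjMatrix_mulVec_apply] at this
  rw [← Finset.sum_div, this]
  simp [mul_div_assoc]

end Spectral

/-! ### Disjoint paths and edges in a neighbourhood -/

theorem exists_two_of_three_le_card {V : Type*} [DecidableEq V] {S : Finset V} (z : V) (h : 3 ≤ #S) :
    ∃ a ∈ S, ∃ b ∈ S, a ≠ b ∧ a ≠ z ∧ b ≠ z := by
  have h2 : 1 < #(S.erase z) := by have := pred_card_le_card_erase (s := S) (a := z); omega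
  obtain ⟨a, ha, b, hb, hab⟩ := one_lt_card.1 h2
  rw [mem_erase] at ha hb
  exact ⟨a, ha.2, b, hb.2, hab, ha.1, hb.1⟩

theorem exists_two_of_four_le_card {V : Type*} [DecidableEq V] {S : Finset V} (y z : V) (h : 4 ≤ #S) :
    ∃ a ∈ S, ∃ b ∈ S, a ≠ b ∧ a ≠ y ∧ b ≠ y ∧ a ≠ z ∧ b ≠ z := by
  have h2 : 3 ≤ #(S.erase y) := by have := pred_card_le_card_erase (s := S) (a := y); omega
  obtain ⟨a, ha, b, hb, hab, haz, hbz⟩ := exists_two_of_three_le_card z h2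
  rw [mem_erase] at ha hb
  exact ⟨a, ha.2, b, hb.2, hab, ha.1, hb.1, haz, hbz⟩

/-- The neighbourhood of a vertex of a fish-free graph contains no disjoint `P_3` and `K_2`. -/
theorem edge_meets_path {V : Type*} {G : SimpleGraph V}
    (hfree : fishGraph.Free G) {o a v b y z : V} (hoa : G.Adj o a)
    (hov : G.Adj o v) (hob : G.Adj o b) (hoy : G.Adj o y) (hoz : G.Adj o z)
    (hva : G.Adj v a) (hvb : G.Adj v b) (hab : a ≠ b) (hyz : G.Adj y z) :
    (y = a ∨ y = v ∨ y = b) ∨ (z = a ∨ z = v ∨ z = b) := by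
  by_contra! h
  obtain ⟨⟨h1, h2, h3⟩, h4, h5, h6⟩ := h
  exact G.false_of_fish hfree hoa hva.symm hvb hob.symm hoy hyz hoz.symm hov.ne hab
    h1.symm h4.symm h2.symm h5.symm h3.symm h6.symm

/-! ### Counting edges and 2-walks from a vertex -/

section Counting
variable {V : Type*} [Fintype V] [DecidableEq V]

/-- The number of common neighbours of `o` and `y`. -/
def codegree (G : SimpleGraph V) [DecidableRel G.Adj] (o y : V) : ℕ :=
  #(G.neighborFinset o ∩ G.neighborFinset y)

/-- The vertices at distance at least two from `o`. -/
def farFinset (G : SimpleGraph V) [DecidableRel G.Adj] (o : V) : Finset V :=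
  (insert o (G.neighborFinset o))ᶜ

variable (G : SimpleGraph V) [DecidableRel G.Adj] (o : V)

theorem mem_farFinset {w : V} : w ∈ farFinset G o ↔ w ≠ o ∧ ¬ G.Adj o w := by
  simp [farFinset]

theorem sum_eq_add_sum_far {M : Type*} [AddCommMonoid M] (f : V → M) :
    ∑ v, f v = f o + ∑ v ∈ G.neighborFinset o, f v + ∑ v ∈ farFinset G o, f v := by
  rw [← sum_insert (by simp : o ∉ G.neighborFinset o), farFinset, sum_add_sum_compl]

theorem sum_sum_neighborFinset (S : Finset V) (x : V → ℝ) :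
    ∑ u ∈ S, ∑ w ∈ G.neighborFinset u, x w = ∑ w, (#(S ∩ G.neighborFinset w) : ℝ) * x w := by
  have h1 : ∀ u, ∑ w ∈ G.neighborFinset u, x w = ∑ w, if G.Adj u w then x w else 0 := fun u => by
    rw [← sum_filter]
    exact sum_congr (by ext; simp) fun _ _ => rfl
  simp_rw [h1]
  rw [sum_comm]
  refine sum_congr rfl fun w _ => ?_
  rw [← sum_filter, sum_const, nsmul_eq_mul]
  congr 3
  ext u
  simp [adj_comm]

theorem sum_card_inter_neighborFinset (S T : Finset V) :
    ∑ u ∈ S, #(T ∩ G.neighborFinset u) = ∑ u ∈ T, #(S ∩ G.neighborFinset u) := by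
  have h := sum_card_bipartiteAbove_eq_sum_card_bipartiteBelow (s := S) (t := T) G.Adj
  convert h using 3 with u _ u _
  · ext; simp [bipartiteAbove]
  · ext; simp [bipartiteBelow, adj_comm]

/-- This is the handshake lemma in the induced subgraph. -/
theorem even_sum_card_inter_neighborFinset (S : Finset V) :
    Even (∑ u ∈ S, #(S ∩ G.neighborFinset u)) := by
  have h := sum_degrees_eq_twice_card_edges (G.induce (S : Set V))
  refine ⟨#(G.induce (S : Set V)).edgeFinset, ?_⟩
  rw [← two_mul, ← h, ← sum_coe_sort]
  refine Fintype.sum_congr _ _ fun u => ?_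
  rw [← card_neighborFinset_eq_degree]
  refine (card_bij (fun a _ => a.1) ?_ ?_ ?_).symm
  · intro a ha
    simpa using ha
  · intro a _ b _ h
    exact Subtype.ext h
  · intro b hb
    simp only [mem_inter, mem_neighborFinset] at hb
    exact ⟨⟨b, hb.1⟩, by simpa using hb.2, rfl⟩

/-- Split the degree sum over `o`, its neighbours and the far vertices; edges between the last two
classes are seen from both ends. -/
theorem two_mul_card_edgeFinset :
    2 * #G.edgeFinset = 2 * #(G.neighborFinset o) + ∑ y ∈ G.neighborFinset o, codegree G o y +
      2 * ∑ w ∈ farFinset G o, codegree G o w +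
      ∑ w ∈ farFinset G o, #(farFinset G o ∩ G.neighborFinset w) := by
  rw [← sum_degrees_eq_twice_card_edges]
  have hdeg : ∀ y, G.degree y = (if G.Adj o y then 1 else 0) + codegree G o y +
      #(farFinset G o ∩ G.neighborFinset y) := fun y => by
    have h := sum_eq_add_sum_far G o fun z => if G.Adj y z then 1 else 0
    simp only [← card_filter] at h
    rw [← card_neighborFinset_eq_degree, codegree]
    convert h using 2
    · ext; simp
    · congr 1
      · simp [adj_comm]
      · congr 1; ext; simp
    · congr 1; ext; simp
  simp_rw [hdeg, sum_add_distrib]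
  rw [sum_eq_add_sum_far G o (codegree G o ·),
    sum_eq_add_sum_far G o fun y => #(farFinset G o ∩ G.neighborFinset y),
    sum_card_inter_neighborFinset G (G.neighborFinset o)]
  have h1 : ∑ y, (if G.Adj o y then 1 else 0) = #(G.neighborFinset o) := by
    rw [← card_filter]
    congr 1; ext; simp
  have h2 : codegree G o o = #(G.neighborFinset o) := by simp [codegree]
  have h3 : farFinset G o ∩ G.neighborFinset o = ∅ := by
    ext w; simp [mem_farFinset]
  rw [h1, h2, h3]
  simp only [codegree, card_empty]
  ring

/-- Apply the eigenvalue equation twice at `o` and group the 2-walks by their endpoint. -/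
theorem sq_eigenvalue_eq {x : V → ℝ} {lam : ℝ} (hxo : x o = 1)
    (he : ∀ v, lam * x v = ∑ w ∈ G.neighborFinset v, x w) :
    lam ^ 2 = #(G.neighborFinset o) + ∑ y ∈ G.neighborFinset o, (codegree G o y : ℝ) * x y +
      ∑ w ∈ farFinset G o, (codegree G o w : ℝ) * x w := by
  have h := sum_sum_neighborFinset G (G.neighborFinset o) x
  simp_rw [← he, ← mul_sum, ← he] at h
  rw [sum_eq_add_sum_far G o, hxo] at h
  simp only [inter_self, mul_one] at h
  rw [sq]
  exact h

variable {G o}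

theorem codegree_pos_iff {y : V} : 0 < codegree G o y ↔ ∃ z, G.Adj o z ∧ G.Adj y z := by
  simp [codegree, card_pos, Finset.Nonempty]

/-- If the neighbourhood of `o` spans more than six edges, not all disjoint, then they form a
star. -/
theorem exists_star_center (hfree : fishGraph.Free G)
    (hD : 12 < ∑ y ∈ G.neighborFinset o, codegree G o y)
    (h2 : ∃ u ∈ G.neighborFinset o, 2 ≤ codegree G o u) :
    ∃ v, G.Adj o v ∧ 4 ≤ codegree G o v ∧
      ∀ y z, G.Adj o y → G.Adj o z → G.Adj y z → y = v ∨ z = v := by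
  obtain ⟨u, hu, hu2⟩ := h2
  obtain ⟨v, hvN, hmax⟩ := exists_max_image (G.neighborFinset o) (codegree G o) ⟨u, hu⟩
  have hv2 := hu2.trans (hmax u hu)
  have hov : G.Adj o v := by simpa using hvN
  by_cases h4 : 4 ≤ codegree G o v
  · refine ⟨v, hov, h4, fun y z hoy hoz hyz => ?_⟩
    by_contra! hne
    -- Four common neighbours suffice to pick a path `a v b` avoiding both ends of the edge `yz`.
    obtain ⟨a, ha, b, hb, hab, hay, hby, haz, hbz⟩ := exists_two_of_four_le_card y z h4
    simp only [mem_inter, mem_neighborFinset] at ha hb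
    have := edge_meets_path hfree ha.1 hov hb.1 hoy hoz ha.2 hb.2 hab hyz
    simp_all [eq_comm]
  exfalso
  -- If `T` contains all vertices of positive codegree, the sum is at most `#T * codegree G o v`.
  have bound : ∀ T : Finset V, (∀ y, G.Adj o y → 0 < codegree G o y → y ∈ T) →
      ∑ y ∈ G.neighborFinset o, codegree G o y ≤ #T * codegree G o v := fun T hT => by
    calc _ = ∑ y ∈ G.neighborFinset o with 0 < codegree G o y, codegree G o y := by
          rw [sum_filter]
          exact sum_congr rfl fun y _ => by split_ifs <;> omega
      _ ≤ #{y ∈ G.neighborFinset o | 0 < codegree G o y} * codegree G o v := by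
          rw [← smul_eq_mul]
          exact sum_le_card_nsmul _ _ _ fun y hy => hmax y (mem_filter.1 hy).1
      _ ≤ _ := by
          gcongr
          intro y hy
          simp only [mem_filter, mem_neighborFinset] at hy
          exact hT y hy.1 hy.2
  -- With maximum codegree `3`, every edge must meet all paths `a v b`, so it lies within `v` and
  -- its three neighbours: the sum is at most `4 * 3 = 12`.
  by_cases h3 : 3 ≤ codegree G o v
  · have hc : codegree G o v = 3 := by omega
    have := bound (insert v (G.neighborFinset o ∩ G.neighborFinset v)) fun y hoy hy => by
      obtain ⟨z, hoz, hyz⟩ := codegree_pos_iff.1 hy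
      by_contra hyT
      simp only [mem_insert, mem_inter, mem_neighborFinset, not_or, not_and] at hyT
      obtain ⟨a, ha, b, hb, hab, haz, hbz⟩ := exists_two_of_three_le_card z h3
      simp only [mem_inter, mem_neighborFinset] at ha hb
      rcases edge_meets_path hfree ha.1 hov hb.1 hoy hoz ha.2 hb.2 hab hyz with
        (rfl | rfl | rfl) | (rfl | rfl | rfl)
      · exact hyT.2 hoy ha.2
      · exact hyT.1 rfl
      · exact hyT.2 hoy hb.2
      · exact haz rfl
      · exact hyT.2 hoy hyz.symm
      · exact hbz rfl
    have hcard := card_insert_le v (G.neighborFinset o ∩ G.neighborFinset v)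
    change _ ≤ codegree G o v + 1 at hcard
    rw [hc] at *
    omega
  -- With maximum codegree `2`, every nonisolated vertex of `N(o)` is adjacent to `a`, `v` or `b`;
  -- there are at most six, giving at most `6 * 2 = 12`.
  · have hc : codegree G o v = 2 := by omega
    obtain ⟨a, b, hab, hS⟩ := card_eq_two.1 hc
    have ha : a ∈ G.neighborFinset o ∩ G.neighborFinset v := by simp [hS]
    have hb : b ∈ G.neighborFinset o ∩ G.neighborFinset v := by simp [hS]
    have ha' := ha
    have hb' := hb
    simp only [mem_inter, mem_neighborFinset] at ha hb
    have hsub := bound ((G.neighborFinset o ∩ G.neighborFinset v) ∪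
      ((G.neighborFinset o ∩ G.neighborFinset a) ∪ (G.neighborFinset o ∩ G.neighborFinset b)))
      fun y hoy hy => by
        obtain ⟨z, hoz, hyz⟩ := codegree_pos_iff.1 hy
        simp only [mem_union, mem_inter, mem_neighborFinset, hoy, true_and]
        rcases edge_meets_path hfree ha.1 hov hb.1 hoy hoz ha.2 hb.2 hab hyz with
          (rfl | rfl | rfl) | (rfl | rfl | rfl)
        · exact Or.inl ha.2
        · exact Or.inr (Or.inl ha.2.symm)
        · exact Or.inl hb.2
        · exact Or.inr (Or.inl hyz.symm)
        · exact Or.inl hyz.symm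
        · exact Or.inr (Or.inr hyz.symm)
    have hc1 := card_union_le (G.neighborFinset o ∩ G.neighborFinset v)
      ((G.neighborFinset o ∩ G.neighborFinset a) ∪ (G.neighborFinset o ∩ G.neighborFinset b))
    have hc2 := card_union_le (G.neighborFinset o ∩ G.neighborFinset a)
      (G.neighborFinset o ∩ G.neighborFinset b)
    have hma := hmax a (by simpa using ha.1)
    have hmb := hmax b (by simpa using hb.1)
    simp only [codegree] at hc hma hmb hsub hD
    rw [hc] at *
    omega

end Counting

/-! ### Neighbourhoods whose edges form a star -/

section Star
variable {V : Type*} [Fintype V] [DecidableEq V] {G : SimpleGraph V} [DecidableRel G.Adj] {o v : V}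

/-- The neighbours of `o` other than `v` that are not adjacent to `v`. -/
def nonadjFinset (G : SimpleGraph V) [DecidableRel G.Adj] (o v : V) : Finset V :=
  {y ∈ G.neighborFinset o | y ≠ v ∧ ¬ G.Adj v y}

theorem mem_nonadjFinset {y : V} :
    y ∈ nonadjFinset G o v ↔ G.Adj o y ∧ y ≠ v ∧ ¬ G.Adj v y := by
  simp [nonadjFinset]

theorem sum_neighborFinset_split {M : Type*} [AddCommMonoid M] (hov : G.Adj o v) (f : V → M) :
    ∑ y ∈ G.neighborFinset o, f y =
      f v + ∑ y ∈ G.neighborFinset o ∩ G.neighborFinset v, f y +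
        ∑ y ∈ nonadjFinset G o v, f y := by
  rw [← sum_insert (by simp), ← sum_union]
  · refine sum_congr ?_ fun _ _ => rfl
    ext y
    simp only [mem_neighborFinset, mem_union, mem_insert, mem_inter, mem_nonadjFinset]
    by_cases hy : y = v
    · simp [hy, hov]
    · tauto
  · rw [Finset.disjoint_left]
    intro y hy
    simp only [mem_insert, mem_inter, mem_neighborFinset] at hy
    rw [mem_nonadjFinset]
    tauto

/-- The edges among the neighbours of `o` form a star centred at `v`. -/
def IsStarCenter (G : SimpleGraph V) (o v : V) : Prop :=
  G.Adj o v ∧ ∀ y z, G.Adj o y → G.Adj o z → G.Adj y z → y = v ∨ z = v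

theorem IsStarCenter.codegree_eq_one (h : IsStarCenter G o v) {y : V} (hoy : G.Adj o y)
    (hvy : G.Adj v y) : codegree G o y = 1 := by
  rw [codegree, card_eq_one]
  refine ⟨v, ?_⟩
  ext z
  simp only [mem_inter, mem_neighborFinset, mem_singleton]
  refine ⟨fun hz => (h.2 y z hoy hz.1 hz.2).resolve_left hvy.ne', ?_⟩
  rintro rfl
  exact ⟨h.1, hvy.symm⟩

theorem IsStarCenter.codegree_eq_zero (h : IsStarCenter G o v) {y : V}
    (hy : y ∈ nonadjFinset G o v) : codegree G o y = 0 := by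
  rw [mem_nonadjFinset] at hy
  rw [← Nat.not_lt.trans Nat.le_zero, codegree_pos_iff]
  rintro ⟨z, hoz, hyz⟩
  rcases h.2 y z hy.1 hoz hyz with rfl | rfl
  · exact hy.2.1 rfl
  · exact hy.2.2 hyz.symm

theorem IsStarCenter.sum_codegree (h : IsStarCenter G o v) :
    ∑ y ∈ G.neighborFinset o, codegree G o y = 2 * codegree G o v := by
  have h1 : ∀ y ∈ G.neighborFinset o ∩ G.neighborFinset v, codegree G o y = 1 := fun y hy => by
    simp only [mem_inter, mem_neighborFinset] at hy
    exact h.codegree_eq_one hy.1 hy.2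
  rw [sum_neighborFinset_split h.1, sum_congr rfl h1,
    sum_congr rfl fun y hy => h.codegree_eq_zero hy, sum_const_zero]
  simp [codegree, two_mul]

theorem IsStarCenter.sum_codegree_mul (h : IsStarCenter G o v) (x : V → ℝ) :
    ∑ y ∈ G.neighborFinset o, (codegree G o y : ℝ) * x y =
      codegree G o v * x v + ∑ y ∈ G.neighborFinset o ∩ G.neighborFinset v, x y := by
  rw [sum_neighborFinset_split h.1, sum_congr rfl fun y hy => ?_,
    sum_congr (s₁ := nonadjFinset G o v) rfl fun y hy => by rw [h.codegree_eq_zero hy]]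
  · simp only [Nat.cast_zero, zero_mul, sum_const_zero, add_zero]
    rfl
  · simp only [mem_inter, mem_neighborFinset] at hy
    rw [h.codegree_eq_one hy.1 hy.2]
    simp

theorem IsStarCenter.card_neighborFinset (h : IsStarCenter G o v) :
    #(G.neighborFinset o) = 1 + codegree G o v + #(nonadjFinset G o v) := by
  have := sum_neighborFinset_split h.1 fun _ => 1
  simpa [codegree] using this

theorem IsStarCenter.neighborFinset_eq_singleton (h : IsStarCenter G o v)
    (hfar : farFinset G o = ∅) {y : V} (hy : y ∈ nonadjFinset G o v) :
    G.neighborFinset y = {o} := by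
  have h0 := h.codegree_eq_zero hy
  have hoy := (mem_nonadjFinset.1 hy).1
  ext z
  rw [mem_neighborFinset, mem_singleton]
  constructor
  · intro hyz
    by_contra hzo
    have : z ∉ farFinset G o := by simp [hfar]
    rw [mem_farFinset, not_and, not_not] at this
    exact absurd (codegree_pos_iff.2 ⟨z, this hzo, hyz⟩) (by omega)
  · rintro rfl
    exact hoy.symm

theorem IsStarCenter.neighborFinset_center (h : IsStarCenter G o v) (hfar : farFinset G o = ∅) :
    G.neighborFinset v = insert o (G.neighborFinset o ∩ G.neighborFinset v) := by
  ext z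
  simp only [mem_insert, mem_inter, mem_neighborFinset]
  have : z ∉ farFinset G o := by simp [hfar]
  rw [mem_farFinset, not_and, not_not] at this
  by_cases hz : z = o
  · simp [hz, h.1.symm]
  · simp [hz, this hz]

/-- A vertex far from `o` has at most two neighbours in common with `o`. -/
theorem IsStarCenter.codegree_far_le (h : IsStarCenter G o v) (hfree : fishGraph.Free G)
    (hr : 3 ≤ codegree G o v) {w : V} (hw : w ∈ farFinset G o) : codegree G o w ≤ 2 := by
  by_contra! hc
  rw [mem_farFinset] at hw
  obtain ⟨a, ha, b, hb, hab, hav, hbv⟩ := exists_two_of_three_le_card v hc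
  simp only [mem_inter, mem_neighborFinset] at ha hb
  have hl : ∃ l, G.Adj o l ∧ G.Adj v l ∧ l ≠ a ∧ l ≠ b := by
    by_contra! hl
    have : #(G.neighborFinset o ∩ G.neighborFinset v) ≤ #{a, b} := card_le_card fun l hl' => by
      simp only [mem_inter, mem_neighborFinset] at hl'
      rw [mem_insert, mem_singleton, or_iff_not_imp_left]
      exact hl l hl'.1 hl'.2
    have := this.trans card_le_two
    change codegree G o v ≤ 2 at this
    omega
  obtain ⟨l, hol, hvl, hla, hlb⟩ := hl
  -- The fish is the 4-cycle `o a w b` with the triangle `o v l`.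
  refine G.false_of_fish hfree ha.1 ha.2.symm hb.2 hb.1.symm h.1 hvl hol.symm hw.1.symm hab hav
    hla.symm ?_ ?_ hbv hlb.symm
  · rintro rfl; exact hw.2 h.1
  · rintro rfl; exact hw.2 hol

end Star

/-! ### Structure forced by a large eigenvalue -/

section Eigenvector
variable {V : Type*} [Fintype V] [DecidableEq V] {G : SimpleGraph V} [DecidableRel G.Adj] {o : V}
  {x : V → ℝ} {lam : ℝ}

theorem exists_isStarCenter (hfree : fishGraph.Free G) (hx0 : ∀ v, 0 ≤ x v) (hx1 : ∀ v, x v ≤ 1)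
    (hxo : x o = 1) (he : ∀ v, lam * x v = ∑ w ∈ G.neighborFinset v, x w) (h8 : 8 < lam)
    (hlam : (#G.edgeFinset : ℝ) - 2 < lam ^ 2 - lam) :
    ∃ v, IsStarCenter G o v ∧ 4 ≤ codegree G o v := by
  have hsq := sq_eigenvalue_eq G o hxo he
  have hm := two_mul_card_edgeFinset G o
  have hsum := he o
  rw [hxo, mul_one] at hsum
  have hm' : (2 : ℝ) * #G.edgeFinset = 2 * #(G.neighborFinset o) +
      ∑ y ∈ G.neighborFinset o, (codegree G o y : ℝ) +
      2 * ∑ w ∈ farFinset G o, (codegree G o w : ℝ) +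
      ∑ w ∈ farFinset G o, (#(farFinset G o ∩ G.neighborFinset w) : ℝ) := by exact_mod_cast hm
  have hF : (0 : ℝ) ≤ ∑ w ∈ farFinset G o, (#(farFinset G o ∩ G.neighborFinset w) : ℝ) :=
    sum_nonneg fun _ _ => by positivity
  have hle : ∀ S : Finset V, ∑ w ∈ S, (codegree G o w : ℝ) * x w ≤ ∑ w ∈ S, (codegree G o w : ℝ) :=
    fun S => sum_le_sum fun w _ => mul_le_of_le_one_right (by positivity) (hx1 w)
  have hN := hle (G.neighborFinset o)
  have hW := hle (farFinset G o)
  -- Bounding `x` by `1` in `λ²` and subtracting the edge count shows that half this sum exceeds `λ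
  -- - 2 > 6`.
  have hD : (12 : ℝ) < ∑ y ∈ G.neighborFinset o, (codegree G o y : ℝ) := by linarith
  have hD' : 12 < ∑ y ∈ G.neighborFinset o, codegree G o y := by exact_mod_cast hD
  obtain ⟨v, hov, h4, hstar⟩ := exists_star_center hfree hD' (by
    by_contra! hc
    have : ∑ y ∈ G.neighborFinset o, (codegree G o y : ℝ) * x y ≤ lam := by
      rw [hsum]
      refine sum_le_sum fun y hy => mul_le_of_le_one_left (hx0 y) ?_
      exact_mod_cast Nat.le_of_lt_succ (hc y hy)
    linarith)
  exact ⟨v, ⟨hov, hstar⟩, h4⟩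

/-- The deficiency identity for a star neighbourhood. -/
theorem IsStarCenter.eigenvalue_identity {v : V} (h : IsStarCenter G o v) (hxo : x o = 1)
    (he : ∀ v, lam * x v = ∑ w ∈ G.neighborFinset v, x w) :
    lam ^ 2 - lam - (#G.edgeFinset - 2) = 1 - (codegree G o v - 1) * (1 - x v) -
      ∑ y ∈ nonadjFinset G o v, x y - ∑ w ∈ farFinset G o, (codegree G o w : ℝ) * (1 - x w) -
      (∑ w ∈ farFinset G o, #(farFinset G o ∩ G.neighborFinset w) : ℕ) / 2 := by
  have hsq := sq_eigenvalue_eq G o hxo he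
  have hm := two_mul_card_edgeFinset G o
  have hsum := he o
  rw [hxo, mul_one, sum_neighborFinset_split h.1] at hsum
  rw [h.sum_codegree] at hm
  rw [h.sum_codegree_mul] at hsq
  have hm' : (2 : ℝ) * #G.edgeFinset = 2 * #(G.neighborFinset o) +
      2 * codegree G o v + 2 * ∑ w ∈ farFinset G o, (codegree G o w : ℝ) +
      (∑ w ∈ farFinset G o, #(farFinset G o ∩ G.neighborFinset w) : ℕ) := by exact_mod_cast hm
  -- In `λ² - λ - m` the degree of `o` and the sum of `x` over the star leaves cancel.
  simp_rw [mul_sub, mul_one, sum_sub_distrib]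
  linarith

theorem IsStarCenter.farFinset_eq_empty {v : V} (h : IsStarCenter G o v)
    (hfree : fishGraph.Free G) (hr : 4 ≤ codegree G o v) (hiso : ∀ v, ¬ G.IsIsolated v)
    (hodd : Odd #G.edgeFinset) (hx0 : ∀ v, 0 ≤ x v) (hx1 : ∀ v, x v ≤ 1)
    (hxo : x o = 1) (he : ∀ v, lam * x v = ∑ w ∈ G.neighborFinset v, x w) (h8 : 8 < lam)
    (hlam : (#G.edgeFinset : ℝ) - 2 < lam ^ 2 - lam) : farFinset G o = ∅ := by
  have hid := h.eigenvalue_identity hxo he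
  have hm := two_mul_card_edgeFinset G o
  rw [h.sum_codegree, h.card_neighborFinset] at hm
  have hFeven := even_sum_card_inter_neighborFinset G (farFinset G o)
  set F := ∑ w ∈ farFinset G o, #(farFinset G o ∩ G.neighborFinset w) with hF
  have hr' : (4 : ℝ) ≤ codegree G o v := by exact_mod_cast hr
  have hA : 0 ≤ ((codegree G o v : ℝ) - 1) * (1 - x v) :=
    mul_nonneg (by linarith) (by linarith [hx1 v])
  have hB : 0 ≤ ∑ y ∈ nonadjFinset G o v, x y := sum_nonneg fun y _ => hx0 y
  have hCterm : ∀ w, 0 ≤ (codegree G o w : ℝ) * (1 - x w) := fun w =>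
    mul_nonneg (by positivity) (by linarith [hx1 w])
  have hC : 0 ≤ ∑ w ∈ farFinset G o, (codegree G o w : ℝ) * (1 - x w) :=
    sum_nonneg fun w _ => hCterm w
  -- `F` counts each far edge twice, and its half is below `1`.
  have hF0 : F = 0 := by
    have : (F : ℝ) < 2 := by linarith
    have : F < 2 := by exact_mod_cast this
    obtain ⟨k, hk⟩ := hFeven
    omega
  rw [hF0, Nat.cast_zero, zero_div, sub_zero] at hid
  rw [hF, sum_eq_zero_iff] at hF0
  have hnbr : ∀ w ∈ farFinset G o,
      G.neighborFinset w = G.neighborFinset o ∩ G.neighborFinset w := by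
    intro w hw
    have h0 := card_eq_zero.1 (hF0 w hw)
    ext z
    simp only [mem_inter, mem_neighborFinset]
    refine ⟨fun hz => ⟨?_, hz⟩, fun hz => hz.2⟩
    by_contra hoz
    have hzo : z ≠ o := by
      rintro rfl
      exact (mem_farFinset G z).1 hw |>.2 hz.symm
    have : z ∈ farFinset G o ∩ G.neighborFinset w := by
      simp [mem_farFinset, hzo, hoz, hz]
    simp [h0] at this
  have hxw : ∀ w ∈ farFinset G o, lam * x w ≤ codegree G o w := fun w hw => by
    rw [he, hnbr w hw, codegree, card_eq_sum_ones]
    push_cast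
    exact sum_le_sum fun z _ => hx1 z
  have hc1 : ∀ w ∈ farFinset G o, 1 ≤ codegree G o w := fun w hw => by
    obtain ⟨z, hz⟩ := not_forall_not.1 (hiso w)
    have : z ∈ G.neighborFinset w := by simpa using hz
    rw [hnbr w hw] at this
    exact card_pos.2 ⟨z, this⟩
  have hc2 : ∀ w ∈ farFinset G o, codegree G o w ≤ 2 := fun w hw =>
    h.codegree_far_le hfree (by omega) hw
  have hx4 : ∀ w ∈ farFinset G o, x w ≤ codegree G o w / 8 := fun w hw => by
    have := hxw w hw
    have := hx0 w
    nlinarith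
  -- Since `x w ≤ c / 8`, codegree `c = 1` costs at least `7/8` and `c = 2` at least `3/2`. The
  -- total is below `1`, so at most one far vertex exists, and its codegree is `1`.
  have hcw : ∀ w ∈ farFinset G o, 7 / 8 ≤ (codegree G o w : ℝ) * (1 - x w) := fun w hw => by
    have := hx4 w hw
    obtain hc | hc : codegree G o w = 1 ∨ codegree G o w = 2 := by
      have := hc1 w hw; have := hc2 w hw; omega
    all_goals rw [hc] at this ⊢; norm_num at this ⊢; linarith
  rw [eq_empty_iff_forall_notMem]
  intro w hw
  have hone : farFinset G o = {w} := by
    refine eq_singleton_iff_unique_mem.2 ⟨hw, fun w' hw' => ?_⟩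
    by_contra hne
    have : ∑ u ∈ {w, w'}, (codegree G o u : ℝ) * (1 - x u) ≤
        ∑ u ∈ farFinset G o, (codegree G o u : ℝ) * (1 - x u) :=
      sum_le_sum_of_subset_of_nonneg (by simp [insert_subset_iff, hw, hw'])
        fun u _ _ => hCterm u
    rw [sum_pair (Ne.symm hne)] at this
    have := hcw w hw
    have := hcw w' hw'
    linarith
  rw [hone, sum_singleton] at hid hm
  have hcw1 : codegree G o w = 1 := by
    have h1 := hc1 w hw
    have h2 := hc2 w hw
    have := hx4 w hw
    by_contra hne
    have h3 : codegree G o w = 2 := by omega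
    rw [h3] at hid this
    norm_num at hid this
    linarith
  -- Such a `y` has `x y ≥ 1/λ ≥ x w`, so `x y` and `1 - x w` would together cost at least `1`.
  have hI : nonadjFinset G o v = ∅ := by
    rw [eq_empty_iff_forall_notMem]
    intro y hy
    have h1 : x y ≤ ∑ y ∈ nonadjFinset G o v, x y :=
      single_le_sum (f := x) (fun z _ => hx0 z) hy
    have h2 : 1 ≤ lam * x y := by
      rw [he, ← hxo]
      refine single_le_sum (f := x) (fun z _ => hx0 z) ?_
      simpa using (mem_nonadjFinset.1 hy).1.symm
    have h3 := hxw w hw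
    rw [hcw1] at hid h3
    norm_num at hid h3
    nlinarith
  -- What remains has `m = 2r + 2`, which is even.
  rw [hcw1, hI, card_empty] at hm
  have : F = 0 := hF ▸ sum_eq_zero hF0
  obtain ⟨k, hk⟩ := hodd
  omega

/-- If nothing is far from `o`, only the book graph and the graph with exactly two pendant
vertices have a large eigenvalue. -/
theorem IsStarCenter.card_nonadjFinset {v : V} (h : IsStarCenter G o v)
    (hfar : farFinset G o = ∅) (hr : 4 ≤ codegree G o v)
    (hodd : Odd #G.edgeFinset) (hxo : x o = 1) (hx1 : ∀ v, x v ≤ 1) (hx0 : ∀ v, 0 ≤ x v)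
    (he : ∀ v, lam * x v = ∑ w ∈ G.neighborFinset v, x w) (h8 : 8 < lam)
    (hlam : (#G.edgeFinset : ℝ) - 2 < lam ^ 2 - lam) :
    #G.edgeFinset = 1 + 2 * codegree G o v + #(nonadjFinset G o v) ∧
    (#(nonadjFinset G o v) = 0 ∨ #(nonadjFinset G o v) = 2 ∧
      (lam ^ 2 - lam - (#G.edgeFinset - 2)) * (lam ^ 2 + lam - 1) = 1) := by
  have hid := h.eigenvalue_identity hxo he
  have hm := two_mul_card_edgeFinset G o
  rw [h.sum_codegree, h.card_neighborFinset] at hm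
  simp only [hfar, sum_empty, Nat.cast_zero, zero_div, sub_zero, mul_zero, add_zero] at hid hm
  have hm1 : #G.edgeFinset = 1 + 2 * codegree G o v + #(nonadjFinset G o v) := by omega
  refine ⟨hm1, ?_⟩
  have hxi : ∀ y ∈ nonadjFinset G o v, lam * x y = 1 := fun y hy => by
    rw [he, h.neighborFinset_eq_singleton hfar hy, sum_singleton, hxo]
  have hI : lam * ∑ y ∈ nonadjFinset G o v, x y = #(nonadjFinset G o v) := by
    rw [mul_sum, sum_congr rfl hxi]
    simp
  have hv := he v
  rw [h.neighborFinset_center hfar, sum_insert (by simp), hxo] at hv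
  have ho := he o
  rw [hxo, mul_one, sum_neighborFinset_split h.1] at ho
  have hmR : (#G.edgeFinset : ℝ) = 1 + 2 * codegree G o v + #(nonadjFinset G o v) := by
    exact_mod_cast hm1
  set s := #(nonadjFinset G o v)
  set r := codegree G o v
  set y := ∑ y ∈ nonadjFinset G o v, x y
  set t := lam ^ 2 - lam - (#G.edgeFinset - 2) with ht
  -- Subtract the eigenvalue equations at `o` and `v`; the leaf sums cancel.
  have hX : (1 - x v) * (lam + 1) = y := by linarith
  have hkey : t * (lam * (lam + 1)) = lam * (lam + 1) - s * (r + lam) := by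
    rw [hid, ← hI]
    linear_combination (-(r : ℝ) + 1) * lam * hX
  have htpos : 0 < t := by linarith
  have hy : 0 ≤ y := sum_nonneg fun z _ => hx0 z
  have hr' : (4 : ℝ) ≤ r := by exact_mod_cast hr
  have ht1 : t ≤ 1 := by
    have : 0 ≤ ((r : ℝ) - 1) * (1 - x v) := mul_nonneg (by linarith) (by linarith [hx1 v])
    linarith
  -- Positivity of `t` gives `s(r + λ) < λ(λ + 1)`, while `t ≤ 1` gives `λ² + λ ≤ 2(r + λ) + s`.
  -- Hence `(s - 2)(r + λ) < s`, impossible for `s ≥ 4`.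
  have hs4 : s < 4 := by
    by_contra! hs
    have hs' : (4 : ℝ) ≤ s := by exact_mod_cast hs
    have hpos : 0 < t * (lam * (lam + 1)) := by positivity
    have : ((s : ℝ) - 2) * (r + lam) ≤ s := by rw [hmR] at ht; nlinarith
    nlinarith
  -- `m = 1 + 2r + s` is odd, so `s` is even.
  obtain hs | hs : s = 0 ∨ s = 2 := by
    obtain ⟨k, hk⟩ := hodd
    omega
  · exact Or.inl hs
  · refine Or.inr ⟨hs, ?_⟩
    rw [hs] at hkey hmR
    push_cast at hkey hmR
    have : t = lam ^ 2 - lam - (2 * r + 1) := by rw [ht, hmR]; ring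
    clear_value t
    linear_combination hkey - this

end Eigenvector

/-! ### Identifying the book and the extremal graph -/

section Iso
variable {V : Type*} [Fintype V] [DecidableEq V] {G : SimpleGraph V} [DecidableRel G.Adj] {o v : V}

theorem adj_of_farFinset_eq_empty (hfar : farFinset G o = ∅) {y : V} (hy : y ≠ o) :
    G.Adj o y := by
  have : y ∉ farFinset G o := by simp [hfar]
  rw [mem_farFinset, not_and, not_not] at this
  exact this hy

/-- Here `o` is adjacent to every other vertex, so the star condition on `N(o)` governs all
remaining edges. -/
theorem IsStarCenter.adj_iff (h : IsStarCenter G o v) (hfar : farFinset G o = ∅) {y z : V}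
    (hy : y ≠ o) (hz : z ≠ o) : G.Adj y z ↔ y = v ∧ G.Adj v z ∨ z = v ∧ G.Adj v y := by
  constructor
  · intro hyz
    rcases h.2 y z (adj_of_farFinset_eq_empty hfar hy) (adj_of_farFinset_eq_empty hfar hz) hyz with
      rfl | rfl
    · exact Or.inl ⟨rfl, hyz⟩
    · exact Or.inr ⟨rfl, hyz.symm⟩
  · rintro (⟨rfl, h'⟩ | ⟨rfl, h'⟩)
    · exact h'
    · exact h'.symm

theorem IsStarCenter.iso_bookGraph (h : IsStarCenter G o v) (hfar : farFinset G o = ∅)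
    (hI : #(nonadjFinset G o v) = 0) : Nonempty (G ≃g bookGraph (codegree G o v)) := by
  let e : ↥(G.neighborFinset o ∩ G.neighborFinset v) ≃ Fin (codegree G o v) := equivFin _
  have he : ∀ i, G.Adj o (e.symm i).1 ∧ G.Adj v (e.symm i).1 := fun i => by
    have := (e.symm i).2
    simpa only [mem_inter, mem_neighborFinset] using this
  have hov := h.1
  let f : Fin 2 ⊕ Fin (codegree G o v) → V := Sum.elim ![o, v] fun i => (e.symm i).1
  have hbij : f.Bijective := by
    constructor
    · rintro (a | a) (b | b) hab
      · fin_cases a <;> fin_cases b <;> simp_all [f, hov.ne, hov.ne']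
      · have h1 := (he b).1.ne; have h2 := (he b).2.ne
        fin_cases a <;> simp_all [f]
      · have h1 := (he a).1.ne'; have h2 := (he a).2.ne'
        fin_cases b <;> simp_all [f]
      · simpa [f, Subtype.val_inj] using hab
    · intro y
      by_cases hyo : y = o
      · exact ⟨Sum.inl 0, by simp [f, hyo]⟩
      by_cases hyv : y = v
      · exact ⟨Sum.inl 1, by simp [f, hyv]⟩
      have hoy := adj_of_farFinset_eq_empty hfar hyo
      have hvy : G.Adj v y := by
        by_contra hn
        have : y ∈ nonadjFinset G o v := mem_nonadjFinset.2 ⟨hoy, hyv, hn⟩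
        simp [card_eq_zero.1 hI] at this
      exact ⟨Sum.inr (e ⟨y, by simp [hoy, hvy]⟩), by simp [f]⟩
  refine ⟨RelIso.symm ⟨Equiv.ofBijective f hbij, ?_⟩⟩
  rintro (a | a) (b | b)
  · fin_cases a <;> fin_cases b <;>
      simp [f, bookGraph, graphJoin, completeG, hov, hov.symm]
  · have h1 := (he b).1; have h2 := (he b).2
    fin_cases a <;> simp [f, bookGraph, graphJoin, h1, h2]
  · have h1 := (he a).1.symm; have h2 := (he a).2.symm
    fin_cases b <;> simp [f, bookGraph, graphJoin, h1, h2]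
  · simp [f, bookGraph, graphJoin, emptyG, h.adj_iff hfar (he a).1.ne' (he b).1.ne',
      (he a).2.ne', (he b).2.ne']

theorem IsStarCenter.iso_extremalGraph (h : IsStarCenter G o v) (hfar : farFinset G o = ∅)
    (hI : #(nonadjFinset G o v) = 2) : Nonempty (G ≃g extremalGraph (codegree G o v)) := by
  let e : ↥(G.neighborFinset o ∩ G.neighborFinset v) ≃ Fin (codegree G o v) := equivFin _
  let p : nonadjFinset G o v ≃ Fin 2 := equivFinOfCardEq hI
  have he : ∀ i, G.Adj o (e.symm i).1 ∧ G.Adj v (e.symm i).1 := fun i => by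
    have := (e.symm i).2
    simpa only [mem_inter, mem_neighborFinset] using this
  have hp : ∀ i, G.Adj o (p.symm i).1 ∧ (p.symm i).1 ≠ v ∧ ¬ G.Adj v (p.symm i).1 := fun i =>
    mem_nonadjFinset.1 (p.symm i).2
  have hov := h.1
  let f : Fin 1 ⊕ ((Fin 1 ⊕ Fin (codegree G o v)) ⊕ Fin 2) → V :=
    Sum.elim (fun _ => o) (Sum.elim (Sum.elim (fun _ => v) fun i => (e.symm i).1)
      fun i => (p.symm i).1)
  have hep : ∀ i j, (e.symm i).1 ≠ (p.symm j).1 := fun i j hij =>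
    (hp j).2.2 (hij ▸ (he i).2)
  have hbij : f.Bijective := by
    constructor
    · rintro (a | (a | a) | a) (b | (b | b) | b) hab
      · rw [Subsingleton.elim a b]
      · exact absurd hab hov.ne
      · exact absurd hab (he b).1.ne
      · exact absurd hab (hp b).1.ne
      · exact absurd hab hov.ne'
      · rw [Subsingleton.elim a b]
      · exact absurd hab (he b).2.ne
      · exact absurd hab (hp b).2.1.symm
      · exact absurd hab (he a).1.ne'
      · exact absurd hab (he a).2.ne'
      · simpa [f, Subtype.val_inj] using hab
      · exact absurd hab (hep a b)
      · exact absurd hab (hp a).1.ne'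
      · exact absurd hab (hp a).2.1
      · exact absurd hab.symm (hep b a)
      · simpa [f, Subtype.val_inj] using hab
    · intro y
      by_cases hyo : y = o
      · exact ⟨Sum.inl 0, by simp [f, hyo]⟩
      by_cases hyv : y = v
      · exact ⟨Sum.inr (Sum.inl (Sum.inl 0)), by simp [f, hyv]⟩
      have hoy := adj_of_farFinset_eq_empty hfar hyo
      by_cases hvy : G.Adj v y
      · exact ⟨Sum.inr (Sum.inl (Sum.inr (e ⟨y, by simp [hoy, hvy]⟩))), by simp [f]⟩
      · exact ⟨Sum.inr (Sum.inr (p ⟨y, mem_nonadjFinset.2 ⟨hoy, hyv, hvy⟩⟩)), by simp [f]⟩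
  refine ⟨RelIso.symm ⟨Equiv.ofBijective f hbij, ?_⟩⟩
  have hadj := fun y z => h.adj_iff hfar (y := y) (z := z)
  rintro (a | (a | a) | a) (b | (b | b) | b)
  · simp [f, extremalGraph, graphJoin, completeG, Subsingleton.elim a b]
  · simp [f, extremalGraph, graphJoin, hov]
  · simp [f, extremalGraph, graphJoin, he]
  · simp [f, extremalGraph, graphJoin, hp]
  · simp [f, extremalGraph, graphJoin, hov.symm]
  · simp [f, extremalGraph, graphJoin, starG]
  · simp [f, extremalGraph, graphJoin, starG, he]
  · simp [f, extremalGraph, graphJoin, hp]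
  · simp [f, extremalGraph, graphJoin, (he a).1.symm]
  · simp [f, extremalGraph, graphJoin, starG, (he a).2.symm]
  · simp [f, extremalGraph, graphJoin, starG, hadj _ _ (he a).1.ne' (he b).1.ne', (he a).2.ne',
      (he b).2.ne']
  · simp [f, extremalGraph, graphJoin, hadj _ _ (he a).1.ne' (hp b).1.ne', (he a).2.ne', hp]
  · simp [f, extremalGraph, graphJoin, (hp a).1.symm]
  · simp [f, extremalGraph, graphJoin, adj_comm, hp]
  · simp [f, extremalGraph, graphJoin, hadj _ _ (hp a).1.ne' (he b).1.ne', (he b).2.ne', hp]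
  · simp [f, extremalGraph, graphJoin, emptyG, hadj _ _ (hp a).1.ne' (hp b).1.ne', hp]

end Iso

/-! ### The converse and the conclusion -/

theorem mem_spectrum_of_iso_extremalGraph {V : Type*} [Fintype V] [DecidableEq V]
    {G : SimpleGraph V} [DecidableRel G.Adj] {k : ℕ} (φ : G ≃g extremalGraph k) {L : ℝ}
    (h0 : L ≠ 0) (hk : L ^ 2 ≠ k)
    (hL : (L ^ 2 - k) * (L ^ 2 - k - 2) = (L + k) ^ 2) :
    L ∈ spectrum ℝ (G.adjMatrix ℝ) := by
  classical
  have hk' : L ^ 2 - k ≠ 0 := sub_ne_zero.2 hk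
  -- `y` is the entry at the star centre when the apex has entry `1`: `hy1` is the equation at the
  -- centre and `hy2` the one at the apex.
  set y : ℝ := (L + k) / (L ^ 2 - k) with hy
  have hy1 : y * (L ^ 2 - k) = L + k := div_mul_cancel₀ _ hk'
  have hy2 : (L + k) * y = L ^ 2 - k - 2 := by
    rw [hy]
    field_simp
    linarith
  let x : Fin 1 ⊕ ((Fin 1 ⊕ Fin k) ⊕ Fin 2) → ℝ :=
    Sum.elim (fun _ => 1) (Sum.elim (Sum.elim (fun _ => y) fun _ => (1 + y) / L) fun _ => 1 / L)
  refine (mem_spectrum_iff_exists_mulVec _ _).2 ⟨x ∘ φ, fun h => ?_, ?_⟩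
  · have := congrFun h (φ.symm (Sum.inl 0))
    simp [x] at this
  · ext u
    have h1 : (G.adjMatrix ℝ).mulVec (x ∘ φ) u =
        ∑ w, (if (extremalGraph k).Adj (φ u) w then 1 else 0) * x w := by
      rw [← φ.toEquiv.sum_comp]
      refine sum_congr rfl fun w _ => ?_
      change G.adjMatrix ℝ u w * x (φ w) =
        (if (extremalGraph k).Adj (φ u) (φ w) then 1 else 0) * x (φ w)
      simp only [adjMatrix_apply, φ.map_adj_iff]
    rw [h1]
    simp only [Pi.smul_apply, Function.comp_apply, smul_eq_mul]
    rcases φ u with a | (a | a) | a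
    · rw [Subsingleton.elim a 0]
      simp [extremalGraph, graphJoin, completeG, x, Fintype.sum_sum_type]
      field_simp
      linarith
    · simp [extremalGraph, graphJoin, starG, x, Fintype.sum_sum_type]
      field_simp
      linarith
    · simp [extremalGraph, graphJoin, starG, x, Fintype.sum_sum_type]
      field_simp
    · simp [extremalGraph, graphJoin, emptyG, x, Fintype.sum_sum_type]
      field_simp

theorem theorem1p1 {V : Type*} [Fintype V] [DecidableEq V] (G : SimpleGraph V)
    [DecidableRel G.Adj] (m : ℕ) (hm : 58 ≤ m) (hodd : Odd m)
    (hfree : fishGraph.Free G)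
    (hedges : G.edgeFinset.card = m)
    (hiso : ∀ v : V, ¬ G.IsIsolated v)
    (hbook : ¬ Nonempty (G ≃g bookGraph ((m - 1) / 2))) :
    ∃ L : ℝ,
      IsGreatest {x : ℝ | x ^ 4 - (m : ℝ) * x ^ 2 - ((m : ℝ) - 3) * x + (m : ℝ) - 3 = 0} L ∧
      graphSpectralRadius G ≤ L ∧
      (graphSpectralRadius G = L ↔ Nonempty (G ≃g extremalGraph ((m - 3) / 2))) := by
  obtain ⟨L, hL, hL8, hLm⟩ := exists_greatest_root m (by exact_mod_cast hm)
  have : Nonempty V := by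
    by_contra hV
    rw [not_nonempty_iff] at hV
    have : G.edgeFinset = ∅ := by
      rw [edgeFinset_eq_empty]
      exact Subsingleton.elim _ _
    rw [this, card_empty] at hedges
    omega
  -- The single assumption `L ≤ λ` serves twice: it refutes `λ > L` and characterises `λ = L`.
  have hlarge : L ≤ graphSpectralRadius G → graphSpectralRadius G ≤ L ∧
      Nonempty (G ≃g extremalGraph ((m - 3) / 2)) := by
    intro hle
    obtain ⟨x, o, hx0, hx1, hxo, he⟩ := exists_normalized_eigenvector G
    have h8 := hL8.trans_le hle
    have hlam := hLm _ hle
    rw [← hedges] at hlam hodd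
    obtain ⟨v, hv, hr⟩ := exists_isStarCenter hfree hx0 hx1 hxo he h8 hlam
    have hfar := hv.farFinset_eq_empty hfree hr hiso hodd hx0 hx1 hxo he h8 hlam
    obtain ⟨hcard, hI | ⟨hI, hroot⟩⟩ :=
      hv.card_nonadjFinset hfar hr hodd hxo hx1 hx0 he h8 hlam
    · refine absurd ?_ hbook
      rw [show (m - 1) / 2 = codegree G o v by omega]
      exact hv.iso_bookGraph hfar hI
    · refine ⟨hL.2 ?_, ?_⟩
      · rw [hedges] at hroot
        change _ = (0 : ℝ)
        linear_combination hroot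
      · rw [show (m - 3) / 2 = codegree G o v by omega]
        exact hv.iso_extremalGraph hfar hI
  have hle : graphSpectralRadius G ≤ L := by
    by_contra! h
    exact absurd (hlarge h.le).1 (not_le.2 h)
  refine ⟨L, hL, hle, fun h => (hlarge h.ge).2, fun ⟨φ⟩ => le_antisymm hle ?_⟩
  -- Oddness makes the natural-number division exact.
  have hmk : m = 2 * ((m - 3) / 2) + 3 := by
    obtain ⟨j, hj⟩ := hodd
    omega
  have hmk' : (m : ℝ) = 2 * ((m - 3) / 2 : ℕ) + 3 := by exact_mod_cast hmk
  have hroot : L ^ 4 - (m : ℝ) * L ^ 2 - ((m : ℝ) - 3) * L + (m : ℝ) - 3 = 0 := hL.1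
  have hLm' := hLm L le_rfl
  rw [hmk'] at hroot hLm'
  refine (le_abs_self L).trans ((graphSpectralRadius_spec G).1 L
    (mem_spectrum_of_iso_extremalGraph φ (by linarith) (fun h => ?_) ?_))
  · rw [← h] at hLm'
    nlinarith
  · linear_combination hroot
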